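/- Let $d\ge 1$, $0<\lambda<1$, and equip $\mathbb Z^d$ with its nearest-neighbour graph structure. Let $o$ be the origin and write $|x|$ for the graph distance from $o$ to $x$. The $\lambda$-biased random walk $(X_n)_{n\ge 0}$ on $\mathbb Z^d$ is the Markov chain with the following transition probabilities $p_\lambda(x,y)$ for adjacent $x,y$ (and $p_\lambda(x,y)=0$ otherwise): $$p_\lambda(x,y)=\begin{cases}\dfrac1{2d}, & x=o,\\[1ex] \dfrac{\lambda}{2d+(\lambda-1)d_x^-}, & x\ne o,\ |y|=|x|-1,\\[1ex] \dfrac{1}{2d+(\lambda-1)d_x^-}, & \text{otherwise,}\end{cases}$$ where $d_x^-$ is the number of neighbours $y$ of $x$ with $|y|=|x|-1$. Let $\mathbb P_x$ be the law of the walk started at $x$, and let $p^{(n)}_\lambda(x,y)=\mathbb P_x(X_n=y)$. (i) For all $x,y\in\mathbb Z^d$, the reciprocal of the radius of convergence of the Green function $\sum_{n\ge0}p^{(n)}_\lambda(x,y)z^n$ (the spectral radius $\rho(\lambda)$) equals $\frac{2\sqrt\lambda}{1+\lambda}$. It is also equal to $\limsup_{n\to\infty}p^{(n)}_\lambda(o,o)^{1/n}$.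 Moreover $\frac{2\sqrt\lambda}{1+\lambda}<1$. (ii) For every starting point $x$, $\mathbb P_x$-almost surely the speed $\lim_{n\to\infty}|X_n|/n$ exists and equals $\frac{1-\lambda}{1+\lambda}$. This number is positive, and it is strictly decreasing as a function of $\lambda\in(0,1)$. (iii) For every starting point $x$, $\mathbb P_x$-almost surely $$\lim_{n\to\infty}\frac1n\bigl(|X_n^1|,\dots,|X_n^d|\bigr)=\frac{1-\lambda}{(1+\lambda)d}\,(1,\dots,1).$$ (iv) For every starting point $x$, $\mathbb P_x$-almost surely the walk is in $\{y\in\mathbb Z^d: y_i=0\text{ for some }i\}$ at only finitely many times. -/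

import Mathlib

open Filter Topology MeasureTheory ProbabilityTheory

noncomputable section

namespace BiasedWalk

section Graph

/-- `d_x^-`: the number of edges from `x` to the sphere of radius `|x| - 1` around the root `o`,
where `|x|` is the graph distance from `o`. (It is `0` at the root.) -/
def closerDegree {V : Type*} (G : SimpleGraph V) [G.LocallyFinite] (o x : V) : ℕ :=
  ((G.neighborFinset x).filter fun y => G.dist o y + 1 = G.dist o x).card

open Classical in
/-- The one-step transition probability `p_λ(x, y)` of the `λ`-biased walk on the rooted graph
`(G, o)`. -/
def transProb {V : Type*} (G : SimpleGraph V) [G.LocallyFinite] (o : V) (lam : ℝ) (x y : V) : ℝ :=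
  if G.Adj x y then
    if x = o then 1 / (G.degree o : ℝ)
    else if G.dist o y + 1 = G.dist o x then
      lam / ((G.degree x : ℝ) + (lam - 1) * (closerDegree G o x : ℝ))
    else 1 / ((G.degree x : ℝ) + (lam - 1) * (closerDegree G o x : ℝ))
  else 0

theorem denom_pos {V : Type*} (G : SimpleGraph V) [G.LocallyFinite] (o : V) {lam : ℝ}
    (hlam : 0 < lam) (x : V) (hx : 0 < G.degree x) :
    0 < (G.degree x : ℝ) + (lam - 1) * (closerDegree G o x : ℝ) := by
  have h1 : (closerDegree G o x : ℝ) ≤ G.degree x := by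
    exact_mod_cast Finset.card_filter_le _ _
  have h2 : (0 : ℝ) < G.degree x := by exact_mod_cast hx
  have h3 : (0 : ℝ) ≤ closerDegree G o x := Nat.cast_nonneg _
  rcases h3.eq_or_lt with h | h
  · rw [← h]; simpa using h2
  · nlinarith [mul_pos hlam h]

theorem transProb_nonneg {V : Type*} (G : SimpleGraph V) [G.LocallyFinite] (o : V) {lam : ℝ}
    (hlam : 0 < lam) (x y : V) (hx : 0 < G.degree x) : 0 ≤ transProb G o lam x y := by
  have h := denom_pos G o hlam x hx
  unfold transProb
  split_ifs <;> positivity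

theorem sum_transProb {V : Type*} (G : SimpleGraph V) [G.LocallyFinite] (o : V) {lam : ℝ}
    (hlam : 0 < lam) (x : V) (hx : 0 < G.degree x) :
    ∑ y ∈ G.neighborFinset x, transProb G o lam x y = 1 := by
  classical
  have h := denom_pos G o hlam x hx
  have hadj : ∀ y ∈ G.neighborFinset x, G.Adj x y := fun y hy => by simpa using hy
  by_cases hxo : x = o
  · subst hxo
    have h2 : (G.degree x : ℝ) ≠ 0 := by exact_mod_cast hx.ne'
    rw [Finset.sum_congr rfl (g := fun _ => 1 / (G.degree x : ℝ))]
    · simp [h2]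
    · intro y hy
      simp [transProb, hadj y hy]
  · rw [Finset.sum_congr rfl (g := fun y =>
      (1 + if G.dist o y + 1 = G.dist o x then lam - 1 else 0) /
        ((G.degree x : ℝ) + (lam - 1) * (closerDegree G o x : ℝ)))]
    · rw [← Finset.sum_div, Finset.sum_add_distrib, ← Finset.sum_filter, div_eq_one_iff_eq h.ne']
      simp [closerDegree]
      ring
    · intro y hy
      simp only [transProb, hadj y hy, hxo, if_true, if_false]
      split_ifs <;> simp

/-- The law of the next position when the walk is at `x`. -/
def stepPMF {V : Type*} (G : SimpleGraph V) [G.LocallyFinite] (o : V) (lam : ℝ)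
    (hG : ∀ x, 0 < G.degree x) (hlam : 0 < lam) (x : V) : PMF V :=
  PMF.ofFinset (fun y => ENNReal.ofReal (transProb G o lam x y)) (G.neighborFinset x)
    (by
      rw [← ENNReal.ofReal_sum_of_nonneg fun y _ => transProb_nonneg G o hlam x y (hG x),
        sum_transProb G o hlam x (hG x), ENNReal.ofReal_one])
    (by
      intro y hy
      have : ¬ G.Adj x y := by simpa using hy
      simp [transProb, this])

/-- The transition kernel of the walk. -/
def stepKernel {V : Type*} [Countable V] [MeasurableSpace V] [DiscreteMeasurableSpace V]
    (G : SimpleGraph V) [G.LocallyFinite] (o : V) (lam : ℝ)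
    (hG : ∀ x, 0 < G.degree x) (hlam : 0 < lam) : Kernel V V :=
  Kernel.ofFunOfCountable fun x => (stepPMF G o lam hG hlam x).toMeasure

instance {V : Type*} [Countable V] [MeasurableSpace V] [DiscreteMeasurableSpace V]
    (G : SimpleGraph V) [G.LocallyFinite] (o : V) (lam : ℝ)
    (hG : ∀ x, 0 < G.degree x) (hlam : 0 < lam) : IsMarkovKernel (stepKernel G o lam hG hlam) :=
  ⟨fun x => PMF.toMeasure.isProbabilityMeasure (stepPMF G o lam hG hlam x)⟩

/-- `ℙ_x`: the law, on the space `ℕ → V` of trajectories, of the `λ`-biased walk on `(G, o)`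
started at `x`. It is the Ionescu-Tulcea measure with `ω 0 = x` for which, given
`ω 0, …, ω n`, the next position `ω (n + 1)` is drawn from the transition kernel at `ω n`. -/
def walkLaw {V : Type*} [Countable V] [MeasurableSpace V] [DiscreteMeasurableSpace V]
    (G : SimpleGraph V) [G.LocallyFinite] (o : V) (lam : ℝ)
    (hG : ∀ x, 0 < G.degree x) (hlam : 0 < lam) (x : V) : Measure (ℕ → V) :=
  Kernel.traj (X := fun _ => V)
    (fun n => (stepKernel G o lam hG hlam).comap
      (fun h : (Π _ : Finset.Iic n, V) => h ⟨n, Finset.mem_Iic.2 le_rfl⟩)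
      (measurable_pi_apply _))
    0 (fun _ => x)

end Graph

section Lattice

/-- The nearest-neighbour graph on `ℤ^d`: edges join `x` and `x + e_i`. -/
def lattice (d : ℕ) : SimpleGraph (Fin d → ℤ) where
  Adj x y := ∃ i, y = x + Pi.single i 1 ∨ x = y + Pi.single i 1
  symm := ⟨fun _ _ ⟨i, h⟩ => ⟨i, h.symm⟩⟩
  loopless := ⟨fun x ⟨i, h⟩ => by
    have := congrFun (h.elim id id) i
    simp at this⟩

theorem lattice_finite_neighborSet (d : ℕ) (x : Fin d → ℤ) :
    ((lattice d).neighborSet x).Finite := by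
  refine ((Set.finite_range fun i : Fin d => x + Pi.single i 1).union
    (Set.finite_range fun i : Fin d => x - Pi.single i 1)).subset ?_
  rintro y ⟨i, h | h⟩
  · exact Or.inl ⟨i, h.symm⟩
  · exact Or.inr ⟨i, by simp [h]⟩

instance (d : ℕ) : (lattice d).LocallyFinite := fun x => (lattice_finite_neighborSet d x).fintype

theorem lattice_degree_pos (d : ℕ) [NeZero d] (x : Fin d → ℤ) : 0 < (lattice d).degree x :=
  ((lattice d).degree_pos_iff_exists_adj x).2 ⟨x + Pi.single 0 1, 0, Or.inl rfl⟩

/-- `ℙ_x` for the `λ`-biased walk on `ℤ^d` rooted at the origin. -/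
def latticeLaw (d : ℕ) [NeZero d] (lam : ℝ) (hlam : 0 < lam) (x : Fin d → ℤ) :
    Measure (ℕ → Fin d → ℤ) :=
  walkLaw (lattice d) 0 lam (lattice_degree_pos d) hlam x

/-- The `n`-step transition probability `p_λ^{(n)}(x, y) = ℙ_x(X_n = y)`. -/
def nStep (d : ℕ) [NeZero d] (lam : ℝ) (hlam : 0 < lam) (n : ℕ) (x y : Fin d → ℤ) : ℝ :=
  (latticeLaw d lam hlam x).real {ω | ω n = y}

/-- The reciprocal of the radius of convergence of the Green function
`∑ n, p_λ^{(n)}(x, y) z ^ n`. -/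
def spectralRadius (d : ℕ) [NeZero d] (lam : ℝ) (hlam : 0 < lam) (x y : Fin d → ℤ) : ENNReal :=
  (FormalMultilinearSeries.ofScalars ℝ fun n => nStep d lam hlam n x y).radius⁻¹

end Lattice

end BiasedWalk

end

/-! Write `W(x) = 2d - (1 - λ) · #{i : x i ≠ 0}`. A step outward along an axis has probability `1 /
W(x)`, a step inward `λ / W(x)`; `W` takes its minimum `d (1 + λ)` exactly off the coordinate
hyperplanes.

Speed. The martingale part of `|X_n^i|` is `o(n)` almost surely (`tendsto_compensated_div`), while
the drift is at least `(1 - λ) / (2d)` everywhere. A zero of coordinate `i` at a large time would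
contradict this, so the hyperplanes are visited finitely often. After the last visit the drift is
the constant `(1 - λ) / ((1 + λ) d)`; averaging gives the coordinate speeds, and their sum is the
speed.

Spectral radius `ρ = 2√λ / (1 + λ)`. The positive function `h(x) = ∏ √λ^|x_j|` satisfies `P h ≤ ρ
h`, which bounds `p^(n)` above by a multiple of `ρ^n`. Conversely, on the box `{1, …, L}^d` the
function `h(x) ∏ sin(π x_j / (L + 1))` is a Dirichlet eigenfunction with eigenvalue `ρ cos(π / (L +
1))`. Irreducibility carries this growth to any target, and `L → ∞` excludes every rate below `ρ`
(`not_eventually_nStep_le`). -/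

namespace BiasedWalk

/-! ### Markov property and a strong law for Lipschitz functions of the walk -/

section Chain

variable {V : Type*} [Countable V] [MeasurableSpace V] [DiscreteMeasurableSpace V]
  (G : SimpleGraph V) [G.LocallyFinite] (o : V) (lam : ℝ)
  (hG : ∀ x, 0 < G.degree x) (hlam : 0 < lam)

instance isProbabilityMeasure_walkLaw (x : V) :
    IsProbabilityMeasure (walkLaw G o lam hG hlam x) := by
  unfold walkLaw; infer_instance

theorem lintegral_stepKernel (x : V) (φ : V → ENNReal) :
    ∫⁻ y, φ y ∂(stepKernel G o lam hG hlam x) =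
      ∑ y ∈ G.neighborFinset x, ENNReal.ofReal (transProb G o lam x y) * φ y := by
  change ∫⁻ y, φ y ∂(stepPMF G o lam hG hlam x).toMeasure = _
  rw [lintegral_countable', tsum_eq_sum (s := G.neighborFinset x)]
  · refine Finset.sum_congr rfl fun y _ => ?_
    rw [PMF.toMeasure_apply_singleton _ _ (measurableSet_singleton y), mul_comm]
    rfl
  · intro y hy
    rw [PMF.toMeasure_apply_singleton _ _ (measurableSet_singleton y)]
    have : ¬ G.Adj x y := by simpa using hy
    simp [stepPMF, PMF.ofFinset_apply, transProb, this]

theorem walkLaw_start (x : V) : ∀ᵐ ω ∂(walkLaw G o lam hG hlam x), ω 0 = x := by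
  have h := Kernel.traj_map_frestrictLe_apply (X := fun _ => V)
    (κ := fun n => (stepKernel G o lam hG hlam).comap
      (fun h : (Π _ : Finset.Iic n, V) => h ⟨n, Finset.mem_Iic.2 le_rfl⟩)
      (measurable_pi_apply _)) 0 0 (fun _ => x)
  rw [Kernel.partialTraj_self, Kernel.id_apply] at h
  have h2 : ∀ᵐ g ∂((walkLaw G o lam hG hlam x).map (Preorder.frestrictLe (π := fun _ => V) 0)),
      g ⟨0, Finset.mem_Iic.2 le_rfl⟩ = x := by
    unfold walkLaw
    rw [h, ae_dirac_eq]
    exact rfl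
  exact ae_of_ae_map (Preorder.measurable_frestrictLe 0).aemeasurable h2

/-- The Markov property in integrated form: conditionally on the first `n` steps, the next position
is drawn from the transition probabilities at `ω n`. -/
theorem lintegral_walkLaw_succ (x : V) (n : ℕ) {A : (ℕ → V) → ENNReal}
    (hA : DependsOn A (Finset.Iic n : Finset ℕ)) (φ : V → V → ENNReal) :
    ∫⁻ ω, A ω * φ (ω n) (ω (n + 1)) ∂(walkLaw G o lam hG hlam x) =
      ∫⁻ ω, A ω * ∑ y ∈ G.neighborFinset (ω n),
        ENNReal.ofReal (transProb G o lam (ω n) y) * φ (ω n) y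
        ∂(walkLaw G o lam hG hlam x) := by
  classical
  set κ : (n : ℕ) → Kernel (Π _ : Finset.Iic n, V) V := fun n =>
    (stepKernel G o lam hG hlam).comap
      (fun h : (Π _ : Finset.Iic n, V) => h ⟨n, Finset.mem_Iic.2 le_rfl⟩)
      (measurable_pi_apply _) with hκ
  let e : (Π _ : Finset.Iic n, V) → V := fun h => h ⟨n, Finset.mem_Iic.2 le_rfl⟩
  -- `A` factors through the history up to time `n`; the value `x` at later times is an arbitrary
  -- filler.
  let B : (Π _ : Finset.Iic n, V) → ENNReal := fun h =>
    A fun k => if hk : k ≤ n then h ⟨k, Finset.mem_Iic.2 hk⟩ else x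
  have hB : ∀ ω, B (Preorder.frestrictLe (π := fun _ => V) n ω) = A ω := by
    intro ω
    refine hA fun k hk => ?_
    have hk' : k ≤ n := by simpa using hk
    simp [hk']
  let F : (Π _ : Finset.Iic n, V) × V → ENNReal := fun q => B q.1 * φ (e q.1) q.2
  have hF : Measurable F := Measurable.of_discrete
  have key := Kernel.partialTraj_compProd_eq_map_traj (X := fun _ => V) (κ := κ)
    (Nat.zero_le n) (x₀ := fun _ => x)
  have hrestr := Kernel.traj_map_frestrictLe_apply (X := fun _ => V) (κ := κ) 0 n (fun _ => x)
  have h1 : ∫⁻ ω, A ω * φ (ω n) (ω (n + 1)) ∂(walkLaw G o lam hG hlam x) =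
      ∫⁻ q, F q ∂((walkLaw G o lam hG hlam x).map
        fun ω => (Preorder.frestrictLe (π := fun _ => V) n ω, ω (n + 1))) := by
    rw [lintegral_map hF (by fun_prop)]
    refine lintegral_congr fun ω => ?_
    simp only [F, hB]
    rfl
  rw [h1]
  change ∫⁻ q, F q ∂((Kernel.traj (X := fun _ => V) κ 0 (fun _ => x)).map _) = _
  rw [← key, Measure.lintegral_compProd hF, ← hrestr,
    lintegral_map Measurable.of_discrete (Preorder.measurable_frestrictLe n)]
  refine lintegral_congr fun ω => ?_
  simp only [F, hB]
  rw [lintegral_const_mul _ Measurable.of_discrete]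
  congr 1
  exact lintegral_stepKernel G o lam hG hlam (ω n) (φ (ω n))

/-- The expected one-step increment of `f`. -/
noncomputable def drift (f : V → ℝ) (x : V) : ℝ :=
  ∑ y ∈ G.neighborFinset x, transProb G o lam x y * (f y - f x)

/-- The martingale part of `f (ω n)` in the Doob decomposition. -/
noncomputable def compensated (f : V → ℝ) (n : ℕ) (ω : ℕ → V) : ℝ :=
  f (ω n) - f (ω 0) - ∑ k ∈ Finset.range n, drift G o lam f (ω k)

variable {f : V → ℝ}

include hG hlam in
omit [Countable V] [MeasurableSpace V] [DiscreteMeasurableSpace V] in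
-- The centred increment is at most `2` in absolute value, so `|s| ≤ 1/2` keeps the exponent `u` in
-- `[-1, 1]`, where `exp u ≤ 1 + u + u²`. The linear term averages to zero, leaving `1 + 4s²`.
theorem sum_transProb_mul_exp_le (hf : ∀ x y, G.Adj x y → |f y - f x| ≤ 1) {s : ℝ}
    (hs : |s| ≤ 1 / 2) (x : V) :
    ∑ y ∈ G.neighborFinset x,
      transProb G o lam x y * Real.exp (s * (f y - f x - drift G o lam f x)) ≤
        Real.exp (4 * s ^ 2) := by
  have hp : ∀ y, 0 ≤ transProb G o lam x y := fun y => transProb_nonneg G o hlam x y (hG x)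
  have hsum := sum_transProb G o hlam x (hG x)
  set δ := drift G o lam f x with hδ
  have hδ1 : |δ| ≤ 1 := by
    calc |δ| ≤ ∑ y ∈ G.neighborFinset x, |transProb G o lam x y * (f y - f x)| :=
          Finset.abs_sum_le_sum_abs _ _
      _ ≤ ∑ y ∈ G.neighborFinset x, transProb G o lam x y := by
          refine Finset.sum_le_sum fun y hy => ?_
          rw [abs_mul, abs_of_nonneg (hp y)]
          exact mul_le_of_le_one_right (hp y) (hf x y (by simpa using hy))
      _ = 1 := hsum
  calc _ ≤ ∑ y ∈ G.neighborFinset x,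
        (transProb G o lam x y * (1 + 4 * s ^ 2 - s * δ) +
          s * (transProb G o lam x y * (f y - f x))) := by
        refine Finset.sum_le_sum fun y hy => ?_
        have hZ : |f y - f x - δ| ≤ 2 := by
          have := abs_sub (f y - f x) δ
          have := hf x y (by simpa using hy)
          linarith
        have hu : |s * (f y - f x - δ)| ≤ 1 := by
          rw [abs_mul]
          calc |s| * |f y - f x - δ| ≤ 1 / 2 * 2 := by gcongr
            _ = 1 := by norm_num
        have h1 := (abs_le.1 (Real.abs_exp_sub_one_sub_id_le hu)).2
        have h2 : (s * (f y - f x - δ)) ^ 2 ≤ 4 * s ^ 2 := by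
          have : (f y - f x - δ) ^ 2 ≤ 2 ^ 2 := sq_le_sq' (abs_le.1 hZ).1 (abs_le.1 hZ).2
          nlinarith [sq_nonneg s]
        have h3 : Real.exp (s * (f y - f x - δ)) ≤ (1 + 4 * s ^ 2 - s * δ) + s * (f y - f x) := by
          linarith
        calc _ ≤ transProb G o lam x y * ((1 + 4 * s ^ 2 - s * δ) + s * (f y - f x)) :=
              mul_le_mul_of_nonneg_left h3 (hp y)
          _ = _ := by ring
    _ = 1 + 4 * s ^ 2 := by
        rw [Finset.sum_add_distrib, ← Finset.sum_mul, ← Finset.mul_sum, hsum]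
        change 1 * _ + s * δ = _
        ring
    _ ≤ Real.exp (4 * s ^ 2) := by linarith [Real.add_one_le_exp (4 * s ^ 2)]

omit [Countable V] [DiscreteMeasurableSpace V] [MeasurableSpace V] in
theorem dependsOn_compensated (f : V → ℝ) (n : ℕ) :
    DependsOn (compensated G o lam f n) (Finset.Iic n : Finset ℕ) := by
  intro ω ω' h
  have h' : ∀ k ≤ n, ω k = ω' k := fun k hk => h k (by simpa using hk)
  unfold compensated
  rw [h' n le_rfl, h' 0 (Nat.zero_le n),
    Finset.sum_congr rfl fun k hk => by rw [h' k (Finset.mem_range.1 hk).le]]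

omit [Countable V] in
theorem measurable_compensated (f : V → ℝ) (n : ℕ) : Measurable (compensated G o lam f n) := by
  have h : ∀ (g : V → ℝ) k, Measurable fun ω : ℕ → V => g (ω k) := fun g k =>
    (Measurable.of_discrete (f := g)).comp (measurable_pi_apply k)
  exact ((h f n).sub (h f 0)).sub (Finset.measurable_sum _ fun k _ => h _ k)

theorem lintegral_exp_compensated_le (hf : ∀ x y, G.Adj x y → |f y - f x| ≤ 1) {s : ℝ}
    (hs : |s| ≤ 1 / 2) (x : V) (n : ℕ) :
    ∫⁻ ω, ENNReal.ofReal (Real.exp (s * compensated G o lam f n ω))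
      ∂(walkLaw G o lam hG hlam x) ≤ ENNReal.ofReal (Real.exp (4 * s ^ 2)) ^ n := by
  induction n with
  | zero => simp [compensated]
  | succ n ih =>
    have hsplit : ∀ ω, ENNReal.ofReal (Real.exp (s * compensated G o lam f (n + 1) ω)) =
        ENNReal.ofReal (Real.exp (s * compensated G o lam f n ω)) *
          ENNReal.ofReal (Real.exp (s * (f (ω (n + 1)) - f (ω n) - drift G o lam f (ω n)))) := by
      intro ω
      rw [← ENNReal.ofReal_mul (Real.exp_nonneg _), ← Real.exp_add]
      congr 2
      simp only [compensated, Finset.sum_range_succ]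
      ring
    simp only [hsplit]
    rw [lintegral_walkLaw_succ G o lam hG hlam x n
      (A := fun ω => ENNReal.ofReal (Real.exp (s * compensated G o lam f n ω)))
      (fun ω ω' h => by simp only [dependsOn_compensated G o lam f n h])
      (fun a b => ENNReal.ofReal (Real.exp (s * (f b - f a - drift G o lam f a))))]
    calc _ ≤ ∫⁻ ω, ENNReal.ofReal (Real.exp (s * compensated G o lam f n ω)) *
          ENNReal.ofReal (Real.exp (4 * s ^ 2)) ∂(walkLaw G o lam hG hlam x) := by
          refine lintegral_mono fun ω => ?_
          gcongr
          refine le_trans (le_of_eq ?_)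
            (ENNReal.ofReal_le_ofReal (sum_transProb_mul_exp_le G o lam hG hlam hf hs (ω n)))
          rw [ENNReal.ofReal_sum_of_nonneg fun y _ =>
            mul_nonneg (transProb_nonneg G o hlam _ y (hG _)) (Real.exp_nonneg _)]
          refine Finset.sum_congr rfl fun y _ => ?_
          rw [ENNReal.ofReal_mul (transProb_nonneg G o hlam _ y (hG _))]
      _ ≤ _ := by
          rw [lintegral_mul_const' _ _ ENNReal.ofReal_ne_top, pow_succ]
          exact mul_le_mul_left ih _

/-- Chernoff and Borel–Cantelli: the threshold `8s²n` is twice the exponent allowed by the moment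
bound, so the expectations of `exp(s M_n - 8s²n)` are dominated by a geometric series of ratio
`exp(-4s²)`. The summed series is then finite almost surely, and its terms tend to `0`. -/
theorem eventually_mul_compensated_le (hf : ∀ x y, G.Adj x y → |f y - f x| ≤ 1) {s : ℝ}
    (hs0 : s ≠ 0) (hs : |s| ≤ 1 / 2) (x : V) :
    ∀ᵐ ω ∂(walkLaw G o lam hG hlam x), ∀ᶠ n : ℕ in atTop,
      s * compensated G o lam f n ω ≤ 8 * s ^ 2 * n := by
  let c : ENNReal := ENNReal.ofReal (Real.exp (-(8 * s ^ 2)))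
  let g : ℕ → (ℕ → V) → ENNReal := fun n ω =>
    c ^ n * ENNReal.ofReal (Real.exp (s * compensated G o lam f n ω))
  have hg : ∀ n, Measurable (g n) := fun n =>
    (((measurable_compensated G o lam f n).const_mul s).exp.ennreal_ofReal).const_mul _
  have hc : c * ENNReal.ofReal (Real.exp (4 * s ^ 2)) < 1 := by
    rw [← ENNReal.ofReal_mul (Real.exp_nonneg _), ← Real.exp_add, ENNReal.ofReal_lt_one]
    rw [Real.exp_lt_one_iff]
    have := pow_pos (abs_pos.2 hs0) 2
    rw [sq_abs] at this
    linarith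
  have hfin : ∫⁻ ω, ∑' n, g n ω ∂(walkLaw G o lam hG hlam x) ≠ ⊤ := by
    rw [lintegral_tsum fun n => (hg n).aemeasurable]
    refine ne_top_of_le_ne_top (b := ∑' n, (c * ENNReal.ofReal (Real.exp (4 * s ^ 2))) ^ n) ?_
      (ENNReal.tsum_le_tsum fun n => ?_)
    · rw [ENNReal.tsum_geometric]
      exact ENNReal.inv_ne_top.2 (tsub_pos_of_lt hc).ne'
    · rw [lintegral_const_mul' _ _ (ENNReal.pow_ne_top ENNReal.ofReal_ne_top), mul_pow]
      gcongr
      exact lintegral_exp_compensated_le G o lam hG hlam hf hs x n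
  filter_upwards [ae_lt_top (Measurable.tsum hg) hfin] with ω hω
  have h0 := ENNReal.tendsto_atTop_zero_of_tsum_ne_top hω.ne
  filter_upwards [h0.eventually (gt_mem_nhds one_pos)] with n hn
  simp only [g, c] at hn
  rw [← ENNReal.ofReal_pow (Real.exp_nonneg _), ← Real.exp_nat_mul,
    ← ENNReal.ofReal_mul (Real.exp_nonneg _), ← Real.exp_add, ENNReal.ofReal_lt_one,
    Real.exp_lt_one_iff] at hn
  linarith

/-- Strong law of large numbers for the martingale part of a Lipschitz function. -/
theorem tendsto_compensated_div (hf : ∀ x y, G.Adj x y → |f y - f x| ≤ 1) (x : V) :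
    ∀ᵐ ω ∂(walkLaw G o lam hG hlam x),
      Tendsto (fun n : ℕ => compensated G o lam f n ω / n) atTop (𝓝 0) := by
  -- Countably many slopes `s = 1 / (m + 2) ≤ 1/2` suffice: using both signs and dividing by `s`
  -- gives `|M_n| ≤ 8 s n`, with `s` arbitrarily small.
  have hpos : ∀ m : ℕ, (0 : ℝ) < 1 / (m + 2) := fun m => by positivity
  have hhalf : ∀ m : ℕ, (1 : ℝ) / (m + 2) ≤ 1 / 2 := fun m => by
    gcongr; linarith [Nat.cast_nonneg (α := ℝ) m]
  have h1 := ae_all_iff.2 fun m : ℕ => eventually_mul_compensated_le G o lam hG hlam hf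
    (s := 1 / (m + 2)) (hpos m).ne' (by rw [abs_of_pos (hpos m)]; exact hhalf m) x
  have h2 := ae_all_iff.2 fun m : ℕ => eventually_mul_compensated_le G o lam hG hlam hf
    (s := -(1 / (m + 2))) (neg_ne_zero.2 (hpos m).ne')
    (by rw [abs_neg, abs_of_pos (hpos m)]; exact hhalf m) x
  filter_upwards [h1, h2] with ω hω1 hω2
  rw [Metric.tendsto_atTop']
  intro ε hε
  obtain ⟨m, hm⟩ := exists_nat_gt (8 / ε)
  have hsε : 8 * (1 / ((m : ℝ) + 2)) < ε := by
    rw [div_lt_iff₀ hε] at hm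
    rw [mul_one_div, div_lt_iff₀ (by positivity)]
    nlinarith
  obtain ⟨N, hN⟩ := eventually_atTop.1 ((hω1 m).and (hω2 m))
  refine ⟨N, fun n hn => ?_⟩
  obtain ⟨ha, hb⟩ := hN n hn.le
  have hn0 : (0 : ℝ) < n := by exact_mod_cast (Nat.zero_le N).trans_lt hn
  set s : ℝ := 1 / ((m : ℝ) + 2) with hs
  have hs0 : 0 < s := hpos m
  rw [Real.dist_eq, sub_zero, abs_div, abs_of_pos hn0, div_lt_iff₀ hn0]
  refine lt_of_le_of_lt ?_ (mul_lt_mul_of_pos_right hsε hn0)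
  refine abs_le.2 ⟨?_, ?_⟩
  · refine le_of_mul_le_mul_left ?_ hs0
    linarith
  · refine le_of_mul_le_mul_left ?_ hs0
    linarith

end Chain

/-! ### Distances, transition probabilities and drift on the lattice -/

section Geometry

variable {d : ℕ}

theorem lattice_adj {x y : Fin d → ℤ} :
    (lattice d).Adj x y ↔ ∃ i, y = x + Pi.single i 1 ∨ x = y + Pi.single i 1 := Iff.rfl

theorem sum_neighborFinset_lattice {M : Type*} [AddCommMonoid M] (x : Fin d → ℤ)
    (φ : (Fin d → ℤ) → M) :
    ∑ y ∈ (lattice d).neighborFinset x, φ y =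
      ∑ i, (φ (x + Pi.single i 1) + φ (x - Pi.single i 1)) := by
  classical
  have hN : (lattice d).neighborFinset x =
      Finset.univ.image (fun i : Fin d => x + Pi.single i 1) ∪
        Finset.univ.image (fun i : Fin d => x - Pi.single i 1) := by
    ext y
    simp only [SimpleGraph.mem_neighborFinset, Finset.mem_union, Finset.mem_image,
      Finset.mem_univ, true_and]
    constructor
    · rintro ⟨i, h | h⟩
      · exact Or.inl ⟨i, h.symm⟩
      · exact Or.inr ⟨i, by simp [h]⟩
    · rintro (⟨i, h⟩ | ⟨i, h⟩)
      · exact ⟨i, Or.inl h.symm⟩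
      · exact ⟨i, Or.inr (by simp [← h])⟩
  have hinj : ∀ i j : Fin d, (Pi.single i (1 : ℤ) : Fin d → ℤ) = Pi.single j 1 → i = j := by
    intro i j h
    by_contra hij
    have := congrFun h i
    simp [hij] at this
  rw [hN, Finset.sum_union, Finset.sum_image, Finset.sum_image, Finset.sum_add_distrib]
  · intro i _ j _ h
    exact hinj i j (by simpa using h)
  · intro i _ j _ h
    exact hinj i j (by simpa using h)
  · rw [Finset.disjoint_left]
    simp only [Finset.mem_image, Finset.mem_univ, true_and, not_exists]
    rintro _ ⟨i, rfl⟩ j h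
    have h2 := congrFun h i
    by_cases hij : i = j
    · subst hij
      simp only [Pi.sub_apply, Pi.add_apply, Pi.single_eq_same] at h2
      omega
    · simp [hij] at h2

theorem lattice_degree (x : Fin d → ℤ) : (lattice d).degree x = 2 * d := by
  rw [← SimpleGraph.card_neighborFinset_eq_degree, Finset.card_eq_sum_ones,
    sum_neighborFinset_lattice]
  simp [mul_comm]

theorem prod_apply_add_single {M : Type*} [CommMonoid M] (w : ℤ → M) (x : Fin d → ℤ) (i : Fin d)
    (c : ℤ) :
    ∏ j, w ((x + Pi.single i c : Fin d → ℤ) j) = w (x i + c) * ∏ j ∈ Finset.univ.erase i, w (x j) := by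
  rw [← Finset.mul_prod_erase _ _ (Finset.mem_univ i)]
  congr 1
  · simp
  · refine Finset.prod_congr rfl fun j hj => ?_
    simp [Finset.ne_of_mem_erase hj]

/-- The `ℓ¹`-norm on `ℤ^d`. -/
def taxicab (x : Fin d → ℤ) : ℕ := ∑ i, (x i).natAbs

/-- The additive form avoids truncated subtraction, so `omega` can compare the norms of neighbours.
-/
theorem taxicab_add_single (x : Fin d → ℤ) (i : Fin d) (c : ℤ) :
    taxicab (x + Pi.single i c) + (x i).natAbs = taxicab x + (x i + c).natAbs := by
  unfold taxicab
  let y : Fin d → ℤ := x + Pi.single i c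
  change ∑ j, (y j).natAbs + _ = _
  rw [← Finset.add_sum_erase Finset.univ (fun j => (y j).natAbs) (Finset.mem_univ i), ← Finset.add_sum_erase Finset.univ (fun j => (x j).natAbs)
    (Finset.mem_univ i), Finset.sum_congr rfl (g := fun j => (x j).natAbs)]
  · simp only [y, Pi.add_apply, Pi.single_eq_same]; ring
  · intro j hj
    simp [y, Finset.ne_of_mem_erase hj]

theorem taxicab_sub_single (x : Fin d → ℤ) (i : Fin d) :
    taxicab (x - Pi.single i 1) + (x i).natAbs = taxicab x + (x i - 1).natAbs := by
  have := taxicab_add_single x i (-1)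
  rwa [Pi.single_neg, ← sub_eq_add_neg, ← sub_eq_add_neg] at this

theorem taxicab_le_of_adj {x y : Fin d → ℤ} (h : (lattice d).Adj x y) :
    taxicab y ≤ taxicab x + 1 := by
  obtain ⟨i, rfl | rfl⟩ := h
  · have := taxicab_add_single x i 1
    omega
  · have := taxicab_add_single y i 1
    omega

theorem exists_walk_zero (n : ℕ) (x : Fin d → ℤ) (hx : taxicab x = n) :
    ∃ p : (lattice d).Walk 0 x, p.length = n := by
  induction n generalizing x with
  | zero =>
    have : x = 0 := by
      funext i
      have := Finset.sum_eq_zero_iff.1 hx i (Finset.mem_univ i)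
      simpa using this
    subst this
    exact ⟨.nil, rfl⟩
  | succ n ih =>
    have hne : ∃ i, x i ≠ 0 := by
      by_contra! hcon
      simp [taxicab, hcon] at hx
    obtain ⟨i, hi⟩ := hne
    rcases lt_or_gt_of_ne hi with h | h
    · have := taxicab_add_single x i 1
      obtain ⟨p, hp⟩ := ih (x + Pi.single i 1) (by omega)
      exact ⟨p.concat (lattice_adj.2 ⟨i, Or.inr rfl⟩), by simp [hp]⟩
    · have := taxicab_sub_single x i
      obtain ⟨p, hp⟩ := ih (x - Pi.single i 1) (by omega)
      exact ⟨p.concat (lattice_adj.2 ⟨i, Or.inl (by simp)⟩), by simp [hp]⟩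

theorem taxicab_le_length {x y : Fin d → ℤ} (p : (lattice d).Walk x y) :
    taxicab y ≤ taxicab x + p.length := by
  induction p with
  | nil => simp
  | cons h p ih =>
    have := taxicab_le_of_adj h
    simp only [SimpleGraph.Walk.length_cons]
    omega

/-- Shrinking a nonzero coordinate one unit at a time gives a walk of the right length, and no edge
raises the `ℓ¹`-norm by more than one. -/
theorem lattice_dist_zero (x : Fin d → ℤ) : (lattice d).dist 0 x = taxicab x := by
  obtain ⟨p, hp⟩ := exists_walk_zero _ x rfl
  refine le_antisymm (hp ▸ SimpleGraph.dist_le p) ?_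
  obtain ⟨q, hq⟩ := SimpleGraph.Reachable.exists_walk_length_eq_dist ⟨p⟩
  have := taxicab_le_length q
  rw [hq] at this
  simpa [taxicab] using this

theorem lattice_connected (d : ℕ) : (lattice d).Connected := by
  have h : ∀ x : Fin d → ℤ, (lattice d).Reachable 0 x := fun x =>
    ⟨(exists_walk_zero _ x rfl).choose⟩
  exact { preconnected := fun x y => (h x).symm.trans (h y), nonempty := ⟨0⟩ }

/-- The number of nonzero coordinates. -/
def nonzeroCount (x : Fin d → ℤ) : ℕ := (Finset.univ.filter fun i => x i ≠ 0).card

theorem nonzeroCount_le (x : Fin d → ℤ) : nonzeroCount x ≤ d := by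
  simpa [nonzeroCount] using Finset.card_filter_le (Finset.univ : Finset (Fin d)) fun i => x i ≠ 0

theorem nonzeroCount_of_forall_ne {x : Fin d → ℤ} (h : ∀ i, x i ≠ 0) : nonzeroCount x = d := by
  simp [nonzeroCount, h]

/-- Along each axis exactly one of the two neighbours is closer to the origin if the coordinate is
nonzero, and neither is if it vanishes. -/
theorem closerDegree_lattice (x : Fin d → ℤ) :
    closerDegree (lattice d) 0 x = nonzeroCount x := by
  rw [closerDegree, Finset.card_filter, sum_neighborFinset_lattice, nonzeroCount,
    Finset.card_filter]
  refine Finset.sum_congr rfl fun i _ => ?_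
  have h1 := taxicab_add_single x i 1
  have h2 := taxicab_sub_single x i
  simp only [lattice_dist_zero]
  split_ifs <;> omega

/-- The total conductance at `x`, normalised so that an outward edge has conductance `1`. -/
noncomputable def totalWeight (lam : ℝ) (x : Fin d → ℤ) : ℝ :=
  2 * d - (1 - lam) * nonzeroCount x

variable {lam : ℝ}

theorem totalWeight_ge (h1 : lam < 1) (x : Fin d → ℤ) : d * (1 + lam) ≤ totalWeight lam x := by
  have : (nonzeroCount x : ℝ) ≤ d := by exact_mod_cast nonzeroCount_le x
  unfold totalWeight
  nlinarith

theorem totalWeight_le (h1 : lam < 1) (x : Fin d → ℤ) : totalWeight lam x ≤ 2 * d := by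
  have : (0 : ℝ) ≤ nonzeroCount x := Nat.cast_nonneg _
  unfold totalWeight
  nlinarith

theorem totalWeight_pos [NeZero d] (h0 : 0 < lam) (h1 : lam < 1) (x : Fin d → ℤ) :
    0 < totalWeight lam x := by
  have : (0 : ℝ) < d := by exact_mod_cast Nat.pos_of_ne_zero (NeZero.ne d)
  exact (by positivity : 0 < (d : ℝ) * (1 + lam)).trans_le (totalWeight_ge h1 x)

theorem totalWeight_of_forall_ne {x : Fin d → ℤ} (h : ∀ i, x i ≠ 0) :
    totalWeight lam x = d * (1 + lam) := by
  rw [totalWeight, nonzeroCount_of_forall_ne h]; ring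

/-- The separate rule at the root is absorbed: there no neighbour is closer and the total weight is
`2d`. -/
theorem transProb_lattice {x y : Fin d → ℤ} (h : (lattice d).Adj x y) :
    transProb (lattice d) 0 lam x y =
      (if taxicab y + 1 = taxicab x then lam else 1) / totalWeight lam x := by
  have hD : ((lattice d).degree x : ℝ) + (lam - 1) * (closerDegree (lattice d) 0 x : ℝ)
      = totalWeight lam x := by
    rw [lattice_degree, closerDegree_lattice, totalWeight]; push_cast; ring
  unfold transProb
  rw [hD]
  simp only [h, if_true, lattice_dist_zero]
  by_cases hx : x = 0
  · subst hx
    simp [taxicab, totalWeight, nonzeroCount, lattice_degree]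
  · simp only [hx, if_false]
    split_ifs <;> rfl

theorem transProb_add_single (x : Fin d → ℤ) (i : Fin d) :
    transProb (lattice d) 0 lam x (x + Pi.single i 1) =
      (if x i < 0 then lam else 1) / totalWeight lam x := by
  rw [transProb_lattice ⟨i, Or.inl rfl⟩]
  have h1 := taxicab_add_single x i 1
  congr 1
  split_ifs <;> first | rfl | omega

theorem transProb_sub_single (x : Fin d → ℤ) (i : Fin d) :
    transProb (lattice d) 0 lam x (x - Pi.single i 1) =
      (if 0 < x i then lam else 1) / totalWeight lam x := by
  rw [transProb_lattice ⟨i, Or.inr (by simp)⟩]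
  have h1 := taxicab_sub_single x i
  congr 1
  split_ifs <;> first | rfl | omega

/-- A product function is an eigenfunction of the transition operator at `x` when each factor
satisfies the corresponding one-dimensional relation. -/
theorem sum_transProb_mul_prod (x : Fin d → ℤ) (w : ℤ → ℝ) (r : ℝ)
    (hw : ∀ i, (if x i < 0 then lam else 1) * w (x i + 1) +
      (if 0 < x i then lam else 1) * w (x i - 1) = r * w (x i)) :
    ∑ y ∈ (lattice d).neighborFinset x, transProb (lattice d) 0 lam x y * ∏ j, w (y j) =
      d * r / totalWeight lam x * ∏ j, w (x j) := by
  rw [sum_neighborFinset_lattice]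
  -- A step along axis `i` changes only the `i`-th factor, so each axis contributes the same
  -- multiple of the product.
  have hterm : ∀ i, transProb (lattice d) 0 lam x (x + Pi.single i 1) *
        ∏ j, w ((x + Pi.single i 1 : Fin d → ℤ) j) +
      transProb (lattice d) 0 lam x (x - Pi.single i 1) *
        ∏ j, w ((x - Pi.single i 1 : Fin d → ℤ) j) =
      r / totalWeight lam x * ∏ j, w (x j) := by
    intro i
    rw [transProb_add_single, transProb_sub_single, prod_apply_add_single,
      sub_eq_add_neg x, ← Pi.single_neg, prod_apply_add_single, ← sub_eq_add_neg,
      ← Finset.mul_prod_erase _ (fun j => w (x j)) (Finset.mem_univ i)]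
    linear_combination (∏ j ∈ Finset.univ.erase i, w (x j)) / totalWeight lam x * hw i
  rw [Finset.sum_congr rfl fun i _ => hterm i]
  simp
  ring

/-- Only steps along axis `i` matter. Off zero, weight `1` outward competes with `λ` inward; at zero
both steps are outward. -/
theorem drift_abs_coord (x : Fin d → ℤ) (i : Fin d) :
    drift (lattice d) 0 lam (fun y => |(y i : ℝ)|) x =
      (if x i = 0 then 2 else 1 - lam) / totalWeight lam x := by
  rw [drift, sum_neighborFinset_lattice, Finset.sum_eq_single i]
  · rw [transProb_add_single, transProb_sub_single]
    simp only [Pi.add_apply, Pi.sub_apply, Pi.single_eq_same]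
    push_cast
    rcases lt_trichotomy (x i) 0 with h | h | h
    · have h' : (x i : ℝ) + 1 ≤ 0 := by exact_mod_cast h
      rw [if_pos h, if_neg h.le.not_gt, if_neg h.ne, abs_of_nonpos h',
        abs_of_nonpos (by linarith : (x i : ℝ) - 1 ≤ 0), abs_of_nonpos (by linarith : (x i : ℝ) ≤ 0)]
      ring
    · simp [h]
      ring
    · have h' : (1 : ℝ) ≤ x i := by exact_mod_cast h
      rw [if_neg h.le.not_gt, if_pos h, if_neg h.ne', abs_of_nonneg (by linarith : 0 ≤ (x i : ℝ) + 1),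
        abs_of_nonneg (by linarith : 0 ≤ (x i : ℝ) - 1), abs_of_nonneg (by linarith : 0 ≤ (x i : ℝ))]
      ring
  · intro j _ hj
    simp [hj.symm]
  · simp

theorem abs_coord_sub_le {x y : Fin d → ℤ} (h : (lattice d).Adj x y) (i : Fin d) :
    |(|(y i : ℝ)| - |(x i : ℝ)|)| ≤ 1 := by
  refine (abs_abs_sub_abs_le _ _).trans ?_
  obtain ⟨j, rfl | rfl⟩ := h <;> by_cases hj : i = j <;> simp [hj]

end Geometry

/-! ### Almost sure speed and avoidance of the coordinate hyperplanes -/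

section Speed

variable {d : ℕ} [NeZero d] {lam : ℝ}

theorem drift_abs_coord_ge (h0 : 0 < lam) (h1 : lam < 1) (x : Fin d → ℤ) (i : Fin d) :
    (1 - lam) / (2 * d) ≤ drift (lattice d) 0 lam (fun y => |(y i : ℝ)|) x := by
  rw [drift_abs_coord]
  have hD := totalWeight_pos h0 h1 x
  refine div_le_div₀ ?_ ?_ hD (totalWeight_le h1 x)
  · split_ifs <;> linarith
  · split_ifs <;> linarith

theorem ae_tendsto_compensated_coord (h0 : 0 < lam) (x : Fin d → ℤ) :
    ∀ᵐ ω ∂(latticeLaw d lam h0 x), ∀ i, Tendsto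
      (fun n : ℕ => compensated (lattice d) 0 lam (fun y => |(y i : ℝ)|) n ω / n) atTop (𝓝 0) :=
  ae_all_iff.2 fun i => tendsto_compensated_div _ _ _ _ _
    (fun _ _ h => abs_coord_sub_le h i) x

variable {ω : ℕ → Fin d → ℤ}

/-- When coordinate `i` vanishes at time `n`, the martingale part is minus the initial value and the
accumulated drift, hence at most `-n (1 - λ) / (2d)`; this is incompatible with `o(n)` for large
`n`. -/
theorem eventually_coord_ne_zero (h0 : 0 < lam) (h1 : lam < 1) (i : Fin d)
    (hω : Tendsto (fun n : ℕ =>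
      compensated (lattice d) 0 lam (fun y => |(y i : ℝ)|) n ω / n) atTop (𝓝 0)) :
    ∀ᶠ n in atTop, ω n i ≠ 0 := by
  have hd : (0 : ℝ) < d := by exact_mod_cast Nat.pos_of_ne_zero (NeZero.ne d)
  have hb : 0 < (1 - lam) / (2 * d) := div_pos (by linarith) (by positivity)
  filter_upwards [hω.eventually (lt_mem_nhds (neg_lt_zero.2 hb)), eventually_gt_atTop 0]
    with n hn hn0 hzero
  have hn0' : (0 : ℝ) < n := by exact_mod_cast hn0
  have hsum : n * ((1 - lam) / (2 * d)) ≤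
      ∑ k ∈ Finset.range n, drift (lattice d) 0 lam (fun y => |(y i : ℝ)|) (ω k) := by
    simpa using Finset.card_nsmul_le_sum (Finset.range n) _ _
      fun k _ => drift_abs_coord_ge h0 h1 (ω k) i
  rw [lt_div_iff₀ hn0'] at hn
  simp only [compensated, hzero, Int.cast_zero, abs_zero] at hn
  linarith [abs_nonneg (ω 0 i : ℝ)]

/-- Once all coordinates stay nonzero, the drift is constant along the path, so its Cesàro means
converge to that constant. -/
theorem tendsto_abs_coord_div (h0 : 0 < lam) (h1 : lam < 1)
    (hω : ∀ i, Tendsto (fun n : ℕ =>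
      compensated (lattice d) 0 lam (fun y => |(y i : ℝ)|) n ω / n) atTop (𝓝 0)) (i : Fin d) :
    Tendsto (fun n : ℕ => |(ω n i : ℝ)| / n) atTop (𝓝 ((1 - lam) / ((1 + lam) * d))) := by
  have hne : ∀ᶠ n in atTop, ∀ j, ω n j ≠ 0 :=
    eventually_all.2 fun j => eventually_coord_ne_zero h0 h1 j (hω j)
  have hdrift : Tendsto (fun n => drift (lattice d) 0 lam (fun y => |(y i : ℝ)|) (ω n)) atTop
      (𝓝 ((1 - lam) / ((1 + lam) * d))) := by
    refine tendsto_const_nhds.congr' ?_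
    filter_upwards [hne] with n hn
    rw [drift_abs_coord, if_neg (hn i), totalWeight_of_forall_ne hn, mul_comm]
  have hconst : Tendsto (fun n : ℕ => |(ω 0 i : ℝ)| / n) atTop (𝓝 0) :=
    tendsto_const_div_atTop_nhds_zero_nat _
  have := ((hω i).add hconst).add hdrift.cesaro
  rw [add_zero, zero_add] at this
  refine this.congr fun n => ?_
  simp only [compensated]
  ring

theorem tendsto_dist_div (h : ∀ i, Tendsto (fun n : ℕ => |(ω n i : ℝ)| / n) atTop
      (𝓝 ((1 - lam) / ((1 + lam) * d)))) :
    Tendsto (fun n : ℕ => ((lattice d).dist 0 (ω n) : ℝ) / n) atTop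
      (𝓝 ((1 - lam) / (1 + lam))) := by
  have hd : (d : ℝ) ≠ 0 := by exact_mod_cast NeZero.ne d
  have hsum := tendsto_finsetSum Finset.univ fun i _ => h i
  have hlim : ∑ _i : Fin d, (1 - lam) / ((1 + lam) * d) = (1 - lam) / (1 + lam) := by
    rw [Finset.sum_const, Finset.card_univ, Fintype.card_fin, nsmul_eq_mul, mul_div_assoc',
      mul_comm (1 + lam), mul_div_mul_left _ _ hd]
  rw [hlim] at hsum
  refine hsum.congr fun n => ?_
  rw [lattice_dist_zero, taxicab, ← Finset.sum_div, Nat.cast_sum]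
  simp [Nat.cast_natAbs]

end Speed

/-! ### Upper and lower bounds for the spectral radius -/

section SpectralRadius

variable {d : ℕ} [NeZero d] {lam : ℝ}

theorem nStep_nonneg (h0 : 0 < lam) (n : ℕ) (x y : Fin d → ℤ) : 0 ≤ nStep d lam h0 n x y :=
  measureReal_nonneg

theorem lattice_transProb_nonneg (h0 : 0 < lam) (x y : Fin d → ℤ) :
    0 ≤ transProb (lattice d) 0 lam x y :=
  transProb_nonneg _ _ h0 x y (lattice_degree_pos d x)

theorem lattice_transProb_pos (h0 : 0 < lam) (h1 : lam < 1) {x y : Fin d → ℤ}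
    (h : (lattice d).Adj x y) : 0 < transProb (lattice d) 0 lam x y := by
  rw [transProb_lattice h]
  refine div_pos ?_ (totalWeight_pos h0 h1 x)
  split_ifs <;> linarith

theorem measurableSet_position {d : ℕ} (n : ℕ) (y : Fin d → ℤ) :
    MeasurableSet {ω : ℕ → Fin d → ℤ | ω n = y} :=
  (measurable_pi_apply (X := fun _ : ℕ => Fin d → ℤ) n) (measurableSet_singleton y)

instance isProbabilityMeasure_latticeLaw (h0 : 0 < lam) (x : Fin d → ℤ) :
    IsProbabilityMeasure (latticeLaw d lam h0 x) := by
  unfold latticeLaw; infer_instance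

theorem ofReal_nStep (h0 : 0 < lam) (n : ℕ) (x y : Fin d → ℤ) :
    ENNReal.ofReal (nStep d lam h0 n x y) = latticeLaw d lam h0 x {ω | ω n = y} :=
  ofReal_measureReal

theorem nStep_zero_self (h0 : 0 < lam) (x : Fin d → ℤ) : nStep d lam h0 0 x x = 1 := by
  have h : latticeLaw d lam h0 x {ω | ω 0 = x} = 1 :=
    (prob_compl_eq_zero_iff (measurableSet_position 0 x)).1
      (walkLaw_start (lattice d) 0 lam (lattice_degree_pos d) h0 x)
  simp [nStep, Measure.real, h]

/-- Chapman–Kolmogorov with only the paths at a point of `B` at time `n` retained; lower bounds need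
no more. -/
theorem sum_nStep_mul_transProb_le (h0 : 0 < lam) (n : ℕ) (x y : Fin d → ℤ)
    (B : Finset (Fin d → ℤ)) :
    ∑ z ∈ B, nStep d lam h0 n x z * transProb (lattice d) 0 lam z y ≤
      nStep d lam h0 (n + 1) x y := by
  classical
  have hp := lattice_transProb_nonneg (d := d) h0
  have hstep := lintegral_walkLaw_succ (lattice d) 0 lam (lattice_degree_pos d) h0 x n
    (A := fun _ => 1) (fun _ _ _ => rfl) (fun _ b => if b = y then 1 else 0)
  have hleft : ∫⁻ ω, (1 : ENNReal) * (if ω (n + 1) = y then 1 else 0) ∂(latticeLaw d lam h0 x) =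
      latticeLaw d lam h0 x {ω | ω (n + 1) = y} := by
    rw [← lintegral_indicator_one (measurableSet_position (n + 1) y)]
    refine lintegral_congr fun ω => ?_
    simp [Set.indicator_apply]
  have hsplit : ∀ ω : ℕ → Fin d → ℤ, ∑ z ∈ B, {ω : ℕ → Fin d → ℤ | ω n = z}.indicator 1 ω *
        ENNReal.ofReal (transProb (lattice d) 0 lam z y) ≤
      1 * ∑ b ∈ (lattice d).neighborFinset (ω n),
        ENNReal.ofReal (transProb (lattice d) 0 lam (ω n) b) * if b = y then 1 else 0 := by
    intro ω
    have hr : ∑ b ∈ (lattice d).neighborFinset (ω n),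
        ENNReal.ofReal (transProb (lattice d) 0 lam (ω n) b) * (if b = y then 1 else 0) =
          ENNReal.ofReal (transProb (lattice d) 0 lam (ω n) y) := by
      simp only [mul_ite, mul_one, mul_zero, Finset.sum_ite_eq', SimpleGraph.mem_neighborFinset]
      split_ifs with h
      · rfl
      · simp [transProb, h]
    rw [one_mul, hr]
    simp only [Set.indicator_apply, Set.mem_ofPred_eq, Pi.one_apply, ite_mul, one_mul, zero_mul,
      Finset.sum_ite_eq]
    split_ifs <;> simp
  rw [← ENNReal.ofReal_le_ofReal_iff (nStep_nonneg h0 _ _ _),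
    ENNReal.ofReal_sum_of_nonneg fun z _ => mul_nonneg (nStep_nonneg h0 _ _ _) (hp z y),
    ofReal_nStep, ← hleft]
  refine le_trans (le_of_eq ?_) ((lintegral_mono hsplit).trans_eq hstep.symm)
  rw [lintegral_finsetSum']
  · refine Finset.sum_congr rfl fun z _ => ?_
    rw [lintegral_mul_const' _ _ ENNReal.ofReal_ne_top,
      lintegral_indicator_one (measurableSet_position n z),
      ENNReal.ofReal_mul (nStep_nonneg h0 _ _ _), ofReal_nStep]
    rfl
  · intro z _
    exact ((measurable_one.indicator (measurableSet_position n z)).mul_const _).aemeasurable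

theorem nStep_mul_transProb_le (h0 : 0 < lam) (n : ℕ) (x z y : Fin d → ℤ) :
    nStep d lam h0 n x z * transProb (lattice d) 0 lam z y ≤ nStep d lam h0 (n + 1) x y := by
  simpa using sum_nStep_mul_transProb_le h0 n x y {z}

/-- Irreducibility: `k` is the length of a fixed path from `z` to `y` and `ε` the product of its
transition probabilities, both independent of `n` and `x`. -/
theorem exists_mul_nStep_le (h0 : 0 < lam) (h1 : lam < 1) (z y : Fin d → ℤ) :
    ∃ k : ℕ, ∃ ε : ℝ, 0 < ε ∧ ∀ n x, ε * nStep d lam h0 n x z ≤ nStep d lam h0 (n + k) x y := by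
  obtain ⟨p⟩ := (lattice_connected d).preconnected z y
  induction p with
  | nil => exact ⟨0, 1, one_pos, fun n x => by simp⟩
  | @cons u v w h p ih =>
    obtain ⟨k, ε, hε, hk⟩ := ih
    refine ⟨k + 1, ε * transProb (lattice d) 0 lam u v,
      mul_pos hε (lattice_transProb_pos h0 h1 h), fun n x => ?_⟩
    calc _ = ε * (nStep d lam h0 n x u * transProb (lattice d) 0 lam u v) := by ring
      _ ≤ ε * nStep d lam h0 (n + 1) x v := by gcongr; exact nStep_mul_transProb_le h0 n x u v
      _ ≤ nStep d lam h0 (n + 1 + k) x w := hk _ _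
      _ = _ := by rw [add_assoc, add_comm 1 k]

/-- An outward step multiplies the factor by `√λ`; an inward one has weight `λ` and divides it by
`√λ`. Every direction therefore contributes `√λ`, and the exact eigenvalue `2d√λ / W(x)` is at most
`ρ` because `W(x) ≥ d (1 + λ)`. -/
theorem sum_transProb_mul_sqrt_pow_le (h0 : 0 < lam) (h1 : lam < 1) (x : Fin d → ℤ) :
    ∑ y ∈ (lattice d).neighborFinset x,
      transProb (lattice d) 0 lam x y * ∏ j, √lam ^ (y j).natAbs ≤
        2 * √lam / (1 + lam) * ∏ j, √lam ^ (x j).natAbs := by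
  have hs : √lam * √lam = lam := Real.mul_self_sqrt h0.le
  have hs0 : 0 < √lam := Real.sqrt_pos.2 h0
  have hd : (0 : ℝ) < d := by exact_mod_cast Nat.pos_of_ne_zero (NeZero.ne d)
  rw [sum_transProb_mul_prod x (fun t => √lam ^ t.natAbs) (2 * √lam)]
  · refine mul_le_mul_of_nonneg_right ?_ (by positivity)
    rw [div_le_div_iff₀ (totalWeight_pos h0 h1 x) (by linarith)]
    nlinarith [totalWeight_ge h1 x]
  · intro i
    have hup : (if x i < 0 then lam else 1) * √lam ^ (x i + 1).natAbs =
        √lam * √lam ^ (x i).natAbs := by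
      split_ifs with h
      · obtain ⟨m, hm⟩ : ∃ m, (x i).natAbs = m + 1 := ⟨(x i).natAbs - 1, by omega⟩
        rw [hm, show (x i + 1).natAbs = m by omega, pow_succ]
        linear_combination (-√lam ^ m) * hs
      · rw [show (x i + 1).natAbs = (x i).natAbs + 1 by omega, pow_succ]
        ring
    have hdown : (if 0 < x i then lam else 1) * √lam ^ (x i - 1).natAbs =
        √lam * √lam ^ (x i).natAbs := by
      split_ifs with h
      · obtain ⟨m, hm⟩ : ∃ m, (x i).natAbs = m + 1 := ⟨(x i).natAbs - 1, by omega⟩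
        rw [hm, show (x i - 1).natAbs = m by omega, pow_succ]
        linear_combination (-√lam ^ m) * hs
      · rw [show (x i - 1).natAbs = (x i).natAbs + 1 by omega, pow_succ]
        ring
    rw [hup, hdown]
    ring

/-- Iterating `P h ≤ ρ h` bounds the expectation of `h(X_n)` by `ρ^n h(x)`; the event `X_n = y`
alone contributes the left side. -/
theorem nStep_mul_prod_sqrt_le (h0 : 0 < lam) (h1 : lam < 1) (n : ℕ) (x y : Fin d → ℤ) :
    nStep d lam h0 n x y * ∏ j, √lam ^ (y j).natAbs ≤
      (2 * √lam / (1 + lam)) ^ n * ∏ j, √lam ^ (x j).natAbs := by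
  let h : (Fin d → ℤ) → ℝ := fun y => ∏ j, √lam ^ (y j).natAbs
  have hh : ∀ y, 0 ≤ h y := fun y => by positivity
  have hρ : 0 ≤ 2 * √lam / (1 + lam) := by positivity
  have key : ∀ n, ∫⁻ ω, ENNReal.ofReal (h (ω n)) ∂(latticeLaw d lam h0 x) ≤
      ENNReal.ofReal (2 * √lam / (1 + lam)) ^ n * ENNReal.ofReal (h x) := by
    intro n
    induction n with
    | zero =>
      have hstart : ∀ᵐ ω ∂(latticeLaw d lam h0 x), ω 0 = x :=
        walkLaw_start (lattice d) 0 lam (lattice_degree_pos d) h0 x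
      rw [lintegral_congr_ae (g := fun _ => ENNReal.ofReal (h x))
        (hstart.mono fun ω hω => by simp only [hω])]
      simp
    | succ n ih =>
      have hstep := lintegral_walkLaw_succ (lattice d) 0 lam (lattice_degree_pos d) h0 x n
        (A := fun _ => 1) (fun _ _ _ => rfl) (fun _ b => ENNReal.ofReal (h b))
      simp only [one_mul] at hstep
      refine (hstep.le.trans (lintegral_mono (g := fun ω =>
        ENNReal.ofReal (2 * √lam / (1 + lam)) * ENNReal.ofReal (h (ω n))) fun ω => ?_)).trans ?_
      · dsimp only
        rw [← ENNReal.ofReal_mul hρ]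
        refine le_trans (le_of_eq ?_)
          (ENNReal.ofReal_le_ofReal (sum_transProb_mul_sqrt_pow_le h0 h1 (ω n)))
        rw [ENNReal.ofReal_sum_of_nonneg fun y _ =>
          mul_nonneg (lattice_transProb_nonneg h0 _ y) (hh y)]
        refine Finset.sum_congr rfl fun y _ => ?_
        rw [ENNReal.ofReal_mul (lattice_transProb_nonneg h0 _ y)]
      · rw [lintegral_const_mul' _ _ ENNReal.ofReal_ne_top, pow_succ', mul_assoc]
        exact mul_le_mul_right ih _
  have hlow : latticeLaw d lam h0 x {ω | ω n = y} * ENNReal.ofReal (h y) ≤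
      ∫⁻ ω, ENNReal.ofReal (h (ω n)) ∂(latticeLaw d lam h0 x) := by
    rw [mul_comm, ← setLIntegral_const]
    refine le_trans (le_of_eq ?_) (setLIntegral_le_lintegral {ω | ω n = y} _)
    refine setLIntegral_congr_fun (measurableSet_position n y) fun ω hω => ?_
    have hω' : ω n = y := hω
    simp only [hω']
  have := hlow.trans (key n)
  rwa [← ofReal_nStep, ← ENNReal.ofReal_mul (nStep_nonneg h0 _ _ _), ← ENNReal.ofReal_pow hρ,
    ← ENNReal.ofReal_mul (pow_nonneg hρ n), ENNReal.ofReal_le_ofReal_iff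
      (mul_nonneg (pow_nonneg hρ n) (hh x))] at this

/-- The principal Dirichlet eigenvalue of the walk killed outside the box `{1, …, L}^d`. -/
theorem sum_box_transProb_mul (h0 : 0 < lam) {L : ℕ} {θ : ℝ}
    (hθ : θ * (L + 1) = Real.pi) {x : Fin d → ℤ}
    (hx : x ∈ Fintype.piFinset fun _ : Fin d => Finset.Icc (1 : ℤ) L) :
    ∑ y ∈ Fintype.piFinset fun _ : Fin d => Finset.Icc (1 : ℤ) L,
      transProb (lattice d) 0 lam x y * ∏ j, (√lam ^ (y j).natAbs * Real.sin (θ * y j)) =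
        2 * √lam / (1 + lam) * Real.cos θ * ∏ j, (√lam ^ (x j).natAbs * Real.sin (θ * x j)) := by
  classical
  have hs : √lam * √lam = lam := Real.mul_self_sqrt h0.le
  have hd : (d : ℝ) ≠ 0 := by exact_mod_cast NeZero.ne d
  have hx' : ∀ i, 1 ≤ x i ∧ x i ≤ L := fun i => by
    simpa using Fintype.mem_piFinset.1 hx i
  have hne : ∀ i, x i ≠ 0 := fun i => by have := hx' i; omega
  set B := Fintype.piFinset fun _ : Fin d => Finset.Icc (1 : ℤ) L with hB
  -- The sum extends to all neighbours for free: one outside the box has a coordinate equal to `0`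
  -- or `L + 1`, where the sine vanishes.
  have hsum : ∑ y ∈ B,
      transProb (lattice d) 0 lam x y * ∏ j, (√lam ^ (y j).natAbs * Real.sin (θ * y j)) =
      ∑ y ∈ (lattice d).neighborFinset x,
        transProb (lattice d) 0 lam x y * ∏ j, (√lam ^ (y j).natAbs * Real.sin (θ * y j)) := by
    refine Finset.sum_congr_of_eq_on_inter ?_ ?_ fun _ _ _ => rfl
    · intro y _ hy
      have : ¬ (lattice d).Adj x y := by simpa using hy
      simp [transProb, this]
    · intro y hy hyB
      have hadj : (lattice d).Adj x y := by simpa using hy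
      obtain ⟨j, hj⟩ : ∃ j, ¬ (1 ≤ y j ∧ y j ≤ L) := by
        by_contra! hcon
        exact hyB (Fintype.mem_piFinset.2 fun j => Finset.mem_Icc.2 (hcon j))
      have hstep : |y j - x j| ≤ 1 := by
        obtain ⟨i, rfl | rfl⟩ := lattice_adj.1 hadj <;> by_cases h : j = i <;> simp [h]
      have hval : y j = 0 ∨ y j = L + 1 := by
        have := hx' j
        rw [abs_le] at hstep
        omega
      have hsin : Real.sin (θ * y j) = 0 := by
        rcases hval with h | h
        · simp [h]
        · rw [h]; push_cast; rw [hθ, Real.sin_pi]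
      rw [Finset.prod_eq_zero (Finset.mem_univ j) (by rw [hsin, mul_zero]), mul_zero]
  rw [hsum, sum_transProb_mul_prod x (fun t => √lam ^ t.natAbs * Real.sin (θ * t))
    (2 * √lam * Real.cos θ), totalWeight_of_forall_ne hne]
  · congr 1
    have : 1 + lam ≠ 0 := by linarith
    field_simp
  · intro i
    obtain ⟨h, -⟩ := hx' i
    -- Box coordinates are positive, so up has weight `1` and down `λ = √λ²`; what remains is
    -- `sin(θ(t+1)) + sin(θ(t-1)) = 2 cos θ sin(θt)`.
    rw [if_neg (by omega), if_pos (by omega)]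
    obtain ⟨m, hm⟩ : ∃ m, (x i).natAbs = m + 1 := ⟨(x i).natAbs - 1, by omega⟩
    rw [hm, show (x i + 1).natAbs = m + 2 by omega, show (x i - 1).natAbs = m by omega]
    push_cast
    rw [mul_add, mul_sub, mul_one, Real.sin_add, Real.sin_sub]
    linear_combination (-√lam ^ m * (Real.sin (θ * x i) * Real.cos θ
      - Real.cos (θ * x i) * Real.sin θ)) * hs

/-- Pairing the law at time `j + n` with the positive eigenfunction `g` grows by at least the
eigenvalue per step, since leaving the box only loses mass. Here `j` is a time at which `(1, …, 1)`
is reached with positive probability, and `g ≤ 1` lets `g` be dropped at the end. -/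
theorem exists_mul_pow_le_sum_box (h0 : 0 < lam) (h1 : lam < 1) {L : ℕ} (hL : 2 ≤ L) {θ : ℝ}
    (hθ : θ * (L + 1) = Real.pi) (x : Fin d → ℤ) :
    ∃ j : ℕ, ∃ c : ℝ, 0 < c ∧ ∀ n, c * (2 * √lam / (1 + lam) * Real.cos θ) ^ n ≤
      ∑ z ∈ Fintype.piFinset fun _ : Fin d => Finset.Icc (1 : ℤ) L,
        nStep d lam h0 (j + n) x z := by
  have hL0 : (0 : ℝ) < L + 1 := by positivity
  have hL3 : (3 : ℝ) ≤ L + 1 := by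
    have : (2 : ℝ) ≤ L := by exact_mod_cast hL
    linarith
  have hpi := Real.pi_pos
  have hθ0 : 0 < θ := by
    rcases pos_and_pos_or_neg_and_neg_of_mul_pos (hθ.symm ▸ hpi) with h | h
    · exact h.1
    · linarith [h.2]
  -- `L ≥ 2` even gives `θ ≤ π/3`; a nonnegative cosine makes `r ≥ 0`, which the induction needs
  -- when multiplying by `r`.
  have hθ2 : θ ≤ Real.pi / 2 := by nlinarith
  have hcos : 0 ≤ Real.cos θ := Real.cos_nonneg_of_neg_pi_div_two_le_of_le (by linarith) hθ2
  have hs0 : 0 < √lam := Real.sqrt_pos.2 h0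
  have hs1 : √lam ≤ 1 := Real.sqrt_le_one.2 h1.le
  set B := Fintype.piFinset fun _ : Fin d => Finset.Icc (1 : ℤ) L with hB
  set r := 2 * √lam / (1 + lam) * Real.cos θ with hr
  have hr0 : 0 ≤ r := by positivity
  let g : (Fin d → ℤ) → ℝ := fun y => ∏ j, (√lam ^ (y j).natAbs * Real.sin (θ * y j))
  have hfac : ∀ z ∈ B, ∀ j, 0 < √lam ^ (z j).natAbs * Real.sin (θ * z j) := by
    intro z hz j
    have hz' := Finset.mem_Icc.1 (Fintype.mem_piFinset.1 hz j)
    have ha : (1 : ℝ) ≤ z j := by exact_mod_cast hz'.1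
    have hb : (z j : ℝ) ≤ L := by exact_mod_cast hz'.2
    refine mul_pos (pow_pos hs0 _) (Real.sin_pos_of_pos_of_lt_pi (by positivity) ?_)
    nlinarith
  have hg0 : ∀ z ∈ B, 0 < g z := fun z hz => Finset.prod_pos fun j _ => hfac z hz j
  have hg1 : ∀ z ∈ B, g z ≤ 1 := fun z hz =>
    Finset.prod_le_one (fun j _ => (hfac z hz j).le) fun j _ =>
      (mul_le_of_le_one_right (by positivity) (Real.sin_le_one _)).trans
        (pow_le_one₀ hs0.le hs1)
  have ha : (fun _ => 1 : Fin d → ℤ) ∈ B :=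
    Fintype.mem_piFinset.2 fun _ => Finset.mem_Icc.2 ⟨le_rfl, by exact_mod_cast (by omega)⟩
  obtain ⟨j, ε, hε, hj⟩ := exists_mul_nStep_le h0 h1 x (fun _ => 1 : Fin d → ℤ)
  have hstart : ε ≤ nStep d lam h0 j x (fun _ => 1) := by
    have := hj 0 x
    rwa [nStep_zero_self, mul_one, zero_add] at this
  have hmain : ∀ n, ε * g (fun _ => 1) * r ^ n ≤ ∑ z ∈ B, nStep d lam h0 (j + n) x z * g z := by
    intro n
    induction n with
    | zero =>
      rw [pow_zero, mul_one, add_zero]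
      refine le_trans (mul_le_mul_of_nonneg_right hstart (hg0 _ ha).le) ?_
      exact Finset.single_le_sum (f := fun z => nStep d lam h0 j x z * g z)
        (fun z hz => mul_nonneg (nStep_nonneg h0 _ _ _) (hg0 z hz).le) ha
    | succ n ih =>
      calc _ = (ε * g (fun _ => 1) * r ^ n) * r := by ring
        _ ≤ (∑ z ∈ B, nStep d lam h0 (j + n) x z * g z) * r := by gcongr
        _ = ∑ z ∈ B, nStep d lam h0 (j + n) x z *
              ∑ y ∈ B, transProb (lattice d) 0 lam z y * g y := by
            rw [Finset.sum_mul]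
            refine Finset.sum_congr rfl fun z hz => ?_
            rw [sum_box_transProb_mul h0 hθ hz]
            ring
        _ = ∑ y ∈ B, (∑ z ∈ B, nStep d lam h0 (j + n) x z *
              transProb (lattice d) 0 lam z y) * g y := by
            simp_rw [Finset.mul_sum, Finset.sum_mul]
            rw [Finset.sum_comm]
            simp_rw [mul_assoc]
        _ ≤ _ := by
            refine Finset.sum_le_sum fun y hy => ?_
            exact mul_le_mul_of_nonneg_right (sum_nStep_mul_transProb_le h0 (j + n) x y B)
              (hg0 y hy).le
  exact ⟨j, ε * g (fun _ => 1), mul_pos hε (hg0 _ ha), fun n => (hmain n).trans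
    (Finset.sum_le_sum fun z hz => mul_le_of_le_one_right (nStep_nonneg h0 _ _ _) (hg1 z hz))⟩

theorem exists_box_rate_gt {r : ℝ} (hr : r < 2 * √lam / (1 + lam)) :
    ∃ L : ℕ, 2 ≤ L ∧ r < 2 * √lam / (1 + lam) * Real.cos (Real.pi / (L + 1)) := by
  have h : Tendsto (fun L : ℕ => 2 * √lam / (1 + lam) * Real.cos (Real.pi / ((L : ℝ) + 1)))
      atTop (𝓝 (2 * √lam / (1 + lam))) := by
    have h1 : Tendsto (fun L : ℕ => Real.pi / ((L : ℝ) + 1)) atTop (𝓝 0) :=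
      tendsto_const_nhds.div_atTop
        (tendsto_atTop_add_const_right _ _ tendsto_natCast_atTop_atTop)
    have h2 := (Real.continuous_cos.tendsto 0).comp h1
    rw [Real.cos_zero] at h2
    simpa using h2.const_mul (2 * √lam / (1 + lam))
  obtain ⟨L, hL⟩ := ((eventually_ge_atTop 2).and (h.eventually (lt_mem_nhds hr))).exists
  exact ⟨L, hL⟩

/-- A bound at `y` would, by irreducibility, bound the total box mass by a multiple of `r^n`,
against its growth at a rate `r' > r`. Negating an eventual bound sidesteps parity: `p^(n)(x, y)`
vanishes for every other `n`, while the shift `k z` may vary with `z`. -/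
theorem not_eventually_nStep_le (h0 : 0 < lam) (h1 : lam < 1) (x y : Fin d → ℤ) {r : ℝ}
    (hr0 : 0 < r) (hr : r < 2 * √lam / (1 + lam)) (C : ℝ) :
    ¬ ∀ᶠ n in atTop, nStep d lam h0 n x y ≤ C * r ^ n := by
  intro hC
  obtain ⟨N, hN⟩ := eventually_atTop.1 hC
  obtain ⟨L, hL, hLr⟩ := exists_box_rate_gt hr
  obtain ⟨j, c, hc, hj⟩ := exists_mul_pow_le_sum_box h0 h1 hL
    (div_mul_cancel₀ Real.pi (by positivity : ((L : ℝ) + 1) ≠ 0)) x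
  set r' := 2 * √lam / (1 + lam) * Real.cos (Real.pi / (L + 1)) with hr'
  set B := Fintype.piFinset fun _ : Fin d => Finset.Icc (1 : ℤ) L
  choose k ε hε hk using fun z => exists_mul_nStep_le (d := d) h0 h1 z y
  have hbound : ∀ n ≥ N, c * r' ^ n ≤ (∑ z ∈ B, (ε z)⁻¹ * (C * r ^ (j + k z))) * r ^ n := by
    intro n hn
    refine (hj n).trans ?_
    rw [Finset.sum_mul]
    refine Finset.sum_le_sum fun z _ => ?_
    have h2 := (hk z (j + n) x).trans (hN _ (by omega))
    rw [mul_assoc, ← div_eq_inv_mul, le_div_iff₀ (hε z), mul_comm]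
    refine h2.trans_eq ?_
    ring
  have hgrow := (tendsto_pow_atTop_atTop_of_one_lt ((one_lt_div hr0).2 hLr)).const_mul_atTop hc
  obtain ⟨n, hn, hn'⟩ := ((eventually_ge_atTop N).and (hgrow.eventually_gt_atTop
    (∑ z ∈ B, (ε z)⁻¹ * (C * r ^ (j + k z))))).exists
  have := hbound n hn
  rw [div_pow, ← mul_div_assoc, lt_div_iff₀ (pow_pos hr0 n)] at hn'
  linarith

theorem spectralRadius_lattice (h0 : 0 < lam) (h1 : lam < 1) (x y : Fin d → ℤ) :
    spectralRadius d lam h0 x y = ENNReal.ofReal (2 * √lam / (1 + lam)) := by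
  have hs0 : 0 < √lam := Real.sqrt_pos.2 h0
  set ρ := 2 * √lam / (1 + lam) with hρ
  have hρ0 : 0 < ρ := by positivity
  have hnorm : ∀ n, ‖FormalMultilinearSeries.ofScalars ℝ (fun n => nStep d lam h0 n x y) n‖ =
      nStep d lam h0 n x y := fun n => by
    rw [FormalMultilinearSeries.ofScalars_norm, Real.norm_of_nonneg (nStep_nonneg h0 _ _ _)]
  rw [spectralRadius, ← inv_inv (ENNReal.ofReal ρ), ← ENNReal.ofReal_inv_of_pos hρ0]
  congr 1
  refine le_antisymm (le_of_not_gt fun hlt => ?_) ?_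
  -- A radius above `ρ⁻¹` would force `p^(n) ≤ C q⁻ⁿ` with `q⁻¹ < ρ`.
  · obtain ⟨q, hq1, hq2⟩ := ENNReal.lt_iff_exists_nnreal_btwn.1 hlt
    have hq : ρ⁻¹ < q := by
      rw [← ENNReal.ofReal_coe_nnreal, ENNReal.ofReal_lt_ofReal_iff_of_nonneg (by positivity)] at hq1
      exact hq1
    have hq0 : (0 : ℝ) < q := (inv_pos.2 hρ0).trans hq
    obtain ⟨C, -, hC⟩ := FormalMultilinearSeries.norm_mul_pow_le_of_lt_radius _ hq2
    refine not_eventually_nStep_le h0 h1 x y (inv_pos.2 hq0) (inv_lt_of_inv_lt₀ hρ0 hq) C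
      (Eventually.of_forall fun n => ?_)
    have := hC n
    rw [hnorm] at this
    rwa [inv_pow, ← div_eq_mul_inv, le_div_iff₀ (pow_pos hq0 n)]
  · have hy : 0 < ∏ j, √lam ^ (y j).natAbs := by positivity
    refine FormalMultilinearSeries.le_radius_of_bound _
      ((∏ j, √lam ^ (x j).natAbs) / ∏ j, √lam ^ (y j).natAbs) fun n => ?_
    rw [hnorm, Real.coe_toNNReal _ (inv_nonneg.2 hρ0.le), le_div_iff₀ hy, inv_pow,
      mul_right_comm, ← div_eq_mul_inv, div_le_iff₀ (pow_pos hρ0 n), mul_comm (∏ j, _)]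
    exact nStep_mul_prod_sqrt_le h0 h1 n x y

theorem limsup_nStep_rpow (h0 : 0 < lam) (h1 : lam < 1) :
    limsup (fun n : ℕ => nStep d lam h0 n 0 0 ^ (1 / (n : ℝ))) atTop = 2 * √lam / (1 + lam) := by
  have hs0 : 0 < √lam := Real.sqrt_pos.2 h0
  set ρ := 2 * √lam / (1 + lam) with hρ
  have hρ0 : 0 < ρ := by positivity
  have hle : ∀ᶠ n : ℕ in atTop, nStep d lam h0 n 0 0 ^ (1 / (n : ℝ)) ≤ ρ := by
    -- At `n = 0` the exponent `1 / 0` is `0` and the root equals `1 > ρ`.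
    filter_upwards [eventually_gt_atTop 0] with n hn
    have hb : nStep d lam h0 n 0 0 ≤ ρ ^ n := by
      simpa using nStep_mul_prod_sqrt_le (d := d) h0 h1 n 0 0
    calc _ ≤ (ρ ^ n) ^ (1 / (n : ℝ)) :=
          Real.rpow_le_rpow (nStep_nonneg h0 _ _ _) hb (by positivity)
      _ = ρ := by rw [one_div, Real.pow_rpow_inv_natCast hρ0.le hn.ne']
  have hnonneg : ∀ n : ℕ, 0 ≤ nStep d lam h0 n 0 0 ^ (1 / (n : ℝ)) := fun n =>
    Real.rpow_nonneg (nStep_nonneg h0 _ _ _) _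
  refine le_antisymm (limsup_le_of_le (isCoboundedUnder_le_of_le _ hnonneg) hle) ?_
  refine le_of_forall_lt_imp_le_of_dense fun r hr => ?_
  -- The maximum with `ρ / 2` keeps the rate positive when `r ≤ 0`.
  have hr' : max r (ρ / 2) < ρ := max_lt hr (by linarith)
  have hr0 : 0 < max r (ρ / 2) := lt_max_of_lt_right (by positivity)
  refine (le_max_left r (ρ / 2)).trans
    (le_limsup_of_frequently_le ?_ ⟨ρ, by simpa using hle⟩)
  refine fun hcon => not_eventually_nStep_le (d := d) h0 h1 0 0 hr0 hr' 1 ?_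
  filter_upwards [hcon, eventually_gt_atTop 0] with n hn hn0
  rw [one_mul, ← Real.rpow_inv_natCast_pow (nStep_nonneg h0 n 0 0) hn0.ne', ← one_div]
  exact pow_le_pow_left₀ (hnonneg n) (not_le.1 hn).le n

end SpectralRadius

end BiasedWalk

theorem theorem1p1 (d : ℕ) [NeZero d] (lam : ℝ) (h0 : 0 < lam) (h1 : lam < 1) :
    -- the spectral radius, as the reciprocal of the convergence radius of any Green function
    (∀ x y : Fin d → ℤ,
      BiasedWalk.spectralRadius d lam h0 x y = ENNReal.ofReal (2 * √lam / (1 + lam))) ∧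
    -- the same number as the exponential rate of the return probabilities
    limsup (fun n : ℕ => BiasedWalk.nStep d lam h0 n 0 0 ^ (1 / (n : ℝ))) atTop
      = 2 * √lam / (1 + lam) ∧
    2 * √lam / (1 + lam) < 1 ∧
    -- the speed, with respect to the graph distance from the origin
    (∀ x : Fin d → ℤ, ∀ᵐ ω ∂(BiasedWalk.latticeLaw d lam h0 x),
      Tendsto (fun n : ℕ => ((BiasedWalk.lattice d).dist 0 (ω n) : ℝ) / n) atTop
        (𝓝 ((1 - lam) / (1 + lam)))) ∧
    0 < (1 - lam) / (1 + lam) ∧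
    StrictAntiOn (fun l : ℝ => (1 - l) / (1 + l)) (Set.Ioo 0 1) ∧
    -- the vector of absolute values of the coordinates
    (∀ x : Fin d → ℤ, ∀ᵐ ω ∂(BiasedWalk.latticeLaw d lam h0 x),
      Tendsto (fun (n : ℕ) (i : Fin d) => ((|ω n i| : ℤ) : ℝ) / n) atTop
        (𝓝 fun _ => (1 - lam) / ((1 + lam) * d))) ∧
    -- finitely many visits to the union of the coordinate hyperplanes
    (∀ x : Fin d → ℤ, ∀ᵐ ω ∂(BiasedWalk.latticeLaw d lam h0 x),
      {n : ℕ | ∃ i, ω n i = 0}.Finite) := by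

  have hspeed : ∀ x : Fin d → ℤ, ∀ᵐ ω ∂(BiasedWalk.latticeLaw d lam h0 x), ∀ i, Tendsto
      (fun n : ℕ => |(ω n i : ℝ)| / n) atTop (𝓝 ((1 - lam) / ((1 + lam) * d))) := fun x =>
    (BiasedWalk.ae_tendsto_compensated_coord h0 x).mono fun _ hω =>
      BiasedWalk.tendsto_abs_coord_div h0 h1 hω
  refine ⟨BiasedWalk.spectralRadius_lattice h0 h1, BiasedWalk.limsup_nStep_rpow h0 h1, ?_,
    fun x => (hspeed x).mono fun _ hω => BiasedWalk.tendsto_dist_div hω,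
    div_pos (by linarith) (by linarith), ?_, fun x => (hspeed x).mono fun ω hω => ?_, fun x => ?_⟩
  · rw [div_lt_one (by linarith)]
    have hlt : √lam < 1 := by
      rw [Real.sqrt_lt' one_pos]
      linarith
    -- This is `(1 - √λ)² > 0`.
    nlinarith [Real.sq_sqrt h0.le, sq_pos_of_pos (sub_pos.2 hlt)]
  · intro a ha b hb hab
    have ha0 : 0 < 1 + a := by linarith [ha.1]
    have hb0 : 0 < 1 + b := by linarith [hb.1]
    simp only
    rw [div_lt_div_iff₀ hb0 ha0]
    linarith
  · rw [tendsto_pi_nhds]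
    intro i
    simpa only [Int.cast_abs] using hω i
  · filter_upwards [BiasedWalk.ae_tendsto_compensated_coord h0 x] with ω hω
    have hne : ∀ᶠ n in atTop, ∀ i, ω n i ≠ 0 :=
      eventually_all.2 fun i => BiasedWalk.eventually_coord_ne_zero h0 h1 i (hω i)
    rw [← Nat.cofinite_eq_atTop, eventually_cofinite] at hne
    simpa using hne
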